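/- A rack (equivalently, a self-distributive braided set) is a nonempty set $X$ with an operation $(x,y)\mapsto x^y$ such that for every $y\in X$ the map $x\mapsto x^y$ is a bijection of $X$, and $(z^x)^y=(z^y)^{x^y}$ for all $x,y,z\in X$; equivalently, $R(x,y)=(y,x^y)$ is a bijection $X\times X\to X\times X$ that satisfies the Yang--Baxter equation $(R\times\mathrm{id})(\mathrm{id}\times R)(R\times\mathrm{id})=(\mathrm{id}\times R)(R\times\mathrm{id})(\mathrm{id}\times R)$. The connected components of $X$ are the classes of the smallest equivalence relation with $x\sim x^y$ for all $x,y\in X$. Elements $x_1,\dots,x_n$ generate $X$ if the only subset $X_0\subseteq X$ that contains all of them and for which $R$ restricts to a bijection $X_0\times X_0\to X_0\times X_0$ is $X$ itself. The braid group $$B_n=\langle\sigma_1,\dots,\sigma_{n-1} : \sigma_i\sigma_j=\sigma_j\sigma_i \text{ for } i>j+1,\ \sigma_i\sigma_{i+1}\sigma_i=\sigma_{i+1}\sigma_i\sigma_{i+1} \text{ for } i<n-1\rangle$$ acts on $X^n$ from the right by $$(x_1,\dots,x_n)^{\sigma_i}=(x_1,\dots,x_{i-1},x_{i+1},x_i^{x_{i+1}},x_{i+2},\dots,x_n),$$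 and maps to $S_n$ by $\sigma_i\mapsto(i\ \ i+1)$. Theorem. For every positive integer $m$ there exists $N$, depending only on $m$, such that the following holds. Let $X$ be a finite rack with $|X|=m$, with connected components $C_1,\dots,C_k$, let $n\ge 1$, and let $s=(x_1,\dots,x_n)\in X^n$. Put $D_j=\{1\le i\le n : x_i\in C_j\}$ and $n_j=|D_j|$ for $1\le j\le k$, and identify $$\{\sigma\in S_n : \sigma(D_j)=D_j \text{ for every } 1\le j\le k\}=S_{n_1}\times\dots\times S_{n_k}$$ by restricting $\sigma$ to each $D_j$. Let $B_{n_1,\dots,n_k}$ be the inverse image of this subgroup in $B_n$. Suppose that $n_j\ge N$ for every $1\le j\le k$, and that $x_1,\dots,x_n$ generate $X$. Then the stabilizer of $s$ in $B_n$ is contained in $B_{n_1,\dots,n_k}$, and its image in $S_{n_1}\times\dots\times S_{n_k}$ contains $A_{n_1}\times\dots\times A_{n_k}$. -/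

import Mathlib

namespace Braided

universe u

/-- `R × id_X` as a self-map of `X × X × X`. -/
def onFirstTwo {X : Type u} (R : X × X → X × X) (p : X × X × X) : X × X × X :=
  ((R (p.1, p.2.1)).1, (R (p.1, p.2.1)).2, p.2.2)

/-- `id_X × R` as a self-map of `X × X × X`. -/
def onLastTwo {X : Type u} (R : X × X → X × X) (p : X × X × X) : X × X × X :=
  (p.1, (R (p.2.1, p.2.2)).1, (R (p.2.1, p.2.2)).2)

/-- A braided set: a nonempty set with a bijective solution `R` of the set-theoretic
Yang--Baxter equation. -/
class BraidedSet (X : Type u) where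
  R : X × X ≃ X × X
  nonempty : Nonempty X
  yang_baxter :
    onFirstTwo R ∘ onLastTwo R ∘ onFirstTwo R = onLastTwo R ∘ onFirstTwo R ∘ onLastTwo R

/-- A braided set is self-distributive if `R (x, y) = (y, x ^ y)` for some operation `x ^ y`.
Such braided sets are the same thing as (nonempty) racks. -/
def IsSelfDistributive (X : Type u) [BraidedSet X] : Prop :=
  ∀ x y : X, (BraidedSet.R (x, y)).1 = y

/-- `X₀` is a braided subset of `X`: `R` restricts to a bijection of `X₀ × X₀` with itself. -/
def IsBraidedSubset {X : Type u} [BraidedSet X] (X₀ : Set X) : Prop :=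
  Set.BijOn (BraidedSet.R : X × X ≃ X × X) (X₀ ×ˢ X₀) (X₀ ×ˢ X₀)

/-- The braided subset generated by a family `x`: the intersection of all the braided subsets
that contain every `x i`. -/
def generated {X : Type u} [BraidedSet X] {ι : Type*} (x : ι → X) : Set X :=
  ⋂₀ {X₀ : Set X | IsBraidedSubset X₀ ∧ ∀ i, x i ∈ X₀}

/-- The smallest equivalence relation on `X` such that `R (x, y) = (z, w)` implies `x ∼ w`
and `y ∼ z`. -/
def componentSetoid (X : Type u) [BraidedSet X] : Setoid X :=
  Relation.EqvGen.setoid fun a b =>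
    ∃ x y z w : X, BraidedSet.R (x, y) = (z, w) ∧ ((a = x ∧ b = w) ∨ (a = y ∧ b = z))

/-- The set of connected components of `X`. -/
def Component (X : Type u) [BraidedSet X] : Type u :=
  Quotient (componentSetoid X)

/-- The connected component of an element. -/
def component {X : Type u} [BraidedSet X] (x : X) : Component X :=
  Quotient.mk (componentSetoid X) x

/-! ### The braid group -/

/-- Position `i` among `n` positions, for `i < n - 1` (positions are counted from `0`). -/
def pos {n : ℕ} (i : Fin (n - 1)) : Fin n := ⟨i, by omega⟩

/-- Position `i + 1` among `n` positions, for `i < n - 1`. -/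
def posSucc {n : ℕ} (i : Fin (n - 1)) : Fin n := ⟨i + 1, by omega⟩

/-- The relators of the Artin presentation of the braid group on `n` strands. -/
def braidRels (n : ℕ) : Set (FreeGroup (Fin (n - 1))) :=
  {r | ∃ i j : Fin (n - 1), (j : ℕ) + 1 < i ∧
      r = FreeGroup.of i * FreeGroup.of j * (FreeGroup.of j * FreeGroup.of i)⁻¹} ∪
  {r | ∃ i j : Fin (n - 1), (i : ℕ) + 1 = j ∧
      r = FreeGroup.of i * FreeGroup.of j * FreeGroup.of i *
        (FreeGroup.of j * FreeGroup.of i * FreeGroup.of j)⁻¹}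

/-- The braid group `B_n`, given by the Artin presentation. -/
abbrev BraidGroup (n : ℕ) : Type := PresentedGroup (braidRels n)

theorem pos_ne_posSucc {n : ℕ} (i : Fin (n - 1)) : pos i ≠ posSucc i := by
  simp [pos, posSucc, Fin.ext_iff]

theorem braid_toPerm_rels (n : ℕ) : ∀ r ∈ braidRels n,
    FreeGroup.lift (fun i : Fin (n - 1) => Equiv.swap (pos i) (posSucc i)) r = 1 := by
  rintro r (⟨i, j, h, rfl⟩ | ⟨i, j, h, rfl⟩)
  · simp only [map_mul, map_inv, FreeGroup.lift_apply_of, mul_inv_eq_one]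
    ext k
    simp only [Equiv.Perm.mul_apply, Equiv.swap_apply_def, pos, posSucc, Fin.ext_iff]
    grind
  · simp only [map_mul, map_inv, FreeGroup.lift_apply_of, mul_inv_eq_one]
    ext k
    simp only [Equiv.Perm.mul_apply, Equiv.swap_apply_def, pos, posSucc, Fin.ext_iff]
    grind

/-- The homomorphism `B_n → S_n` sending `σ_i` to the transposition `(i, i + 1)`. -/
def braidToPerm (n : ℕ) : BraidGroup n →* Equiv.Perm (Fin n) :=
  PresentedGroup.toGroup (braid_toPerm_rels n)

/-- Apply `e` to the entries at positions `i` and `i + 1` of an `n`-tuple. -/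
def applyAt {X : Type u} {n : ℕ} (e : X × X → X × X) (i : Fin (n - 1)) (x : Fin n → X) :
    Fin n → X := fun k =>
  if k = pos i then (e (x (pos i), x (posSucc i))).1
  else if k = posSucc i then (e (x (pos i), x (posSucc i))).2
  else x k

theorem applyAt_leftInverse {X : Type u} {n : ℕ} {e f : X × X → X × X}
    (h : Function.LeftInverse f e) (i : Fin (n - 1)) :
    Function.LeftInverse (applyAt f i) (applyAt e i) := by
  intro x
  funext k
  have h1 := pos_ne_posSucc i
  by_cases hk : k = pos i
  · subst hk; simp [applyAt, h1.symm, h _]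
  · by_cases hk' : k = posSucc i
    · subst hk'; simp [applyAt, h1.symm, h _]
    · simp [applyAt, hk, hk']

/-- The bijection `id × R × id` of `X ^ n`, with `R` at positions `i` and `i + 1`. -/
def sigmaPerm (X : Type u) [BraidedSet X] (n : ℕ) (i : Fin (n - 1)) :
    Equiv.Perm (Fin n → X) where
  toFun := applyAt BraidedSet.R i
  invFun := applyAt BraidedSet.R.symm i
  left_inv := applyAt_leftInverse BraidedSet.R.left_inv i
  right_inv := applyAt_leftInverse BraidedSet.R.right_inv i

theorem sigmaPerm_rels (X : Type u) [BraidedSet X] (n : ℕ) : ∀ r ∈ braidRels n,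
    FreeGroup.lift (fun i : Fin (n - 1) => MulOpposite.op (sigmaPerm X n i)) r = 1 := by
  rintro r (⟨i, j, h, rfl⟩ | ⟨i, j, h, rfl⟩)
  · simp only [map_mul, map_inv, FreeGroup.lift_apply_of, mul_inv_eq_one]
    rw [← MulOpposite.op_mul, ← MulOpposite.op_mul]
    congr 1
    ext x k
    simp only [Equiv.Perm.mul_apply, sigmaPerm, Equiv.coe_fn_mk, applyAt, pos, posSucc,
      Fin.ext_iff]
    grind
  · simp only [map_mul, map_inv, FreeGroup.lift_apply_of, mul_inv_eq_one]
    simp only [← MulOpposite.op_mul]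
    congr 1
    ext x k
    have hp : posSucc i = pos j := by simp [pos, posSucc, h]
    have h1 := pos_ne_posSucc i
    have h2 := pos_ne_posSucc j
    have h3 : pos i ≠ posSucc j := by simp [pos, posSucc, Fin.ext_iff]; omega
    rw [hp] at h1
    have yb := congrFun (BraidedSet.yang_baxter (X := X)) (x (pos i), x (pos j), x (posSucc j))
    have y1 := congrArg (fun p => p.1) yb
    have y2 := congrArg (fun p => p.2.1) yb
    have y3 := congrArg (fun p => p.2.2) yb
    simp only [Function.comp, onFirstTwo, onLastTwo] at y1 y2 y3
    simp only [Equiv.Perm.mul_apply, sigmaPerm, Equiv.coe_fn_mk, applyAt, hp]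
    by_cases hk1 : k = pos i
    · subst hk1
      simp [h1, h1.symm, h2.symm, h3, h3.symm, y1]
    by_cases hk2 : k = pos j
    · subst hk2
      simp [h1, h1.symm, h2.symm, h3, h3.symm, y2]
    by_cases hk3 : k = posSucc j
    · subst hk3
      simp [h1, h1.symm, h2.symm, h3, h3.symm, y3]
    simp [hk1, hk2, hk3]

/-- The right action of `B_n` on `X ^ n`, in which `σ_i` acts through `id × R × id`. A right
action by permutations is a homomorphism to the opposite of the group `Equiv.Perm`. -/
def braidAction (X : Type u) [BraidedSet X] (n : ℕ) :
    BraidGroup n →* (Equiv.Perm (Fin n → X))ᵐᵒᵖ :=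
  PresentedGroup.toGroup (sigmaPerm_rels X n)

/-- The stabilizer in `B_n` of a tuple `s`. -/
def braidStabilizer {X : Type u} [BraidedSet X] {n : ℕ} (s : Fin n → X) :
    Subgroup (BraidGroup n) where
  carrier := {g | (braidAction X n g).unop s = s}
  one_mem' := by simp
  mul_mem' := by
    intro a b ha hb
    simp only [Set.mem_ofPred_eq] at ha hb ⊢
    rw [map_mul, MulOpposite.unop_mul, Equiv.Perm.mul_apply, ha, hb]
  inv_mem' := by
    intro a ha
    simp only [Set.mem_ofPred_eq] at ha ⊢
    rw [map_inv, MulOpposite.unop_inv, Equiv.Perm.inv_eq_iff_eq, ha]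

/-! ### Products of symmetric groups inside `S_n` -/

/-- `D_c`: the set of positions at which the entry of `s` lies in the component `c`. -/
def block {X : Type u} [BraidedSet X] {n : ℕ} (s : Fin n → X) (c : Component X) :
    Set (Fin n) :=
  {i | component (s i) = c}

/-- The subgroup of all `σ ∈ S_n` such that `σ(D_c) = D_c` for every component `c`. -/
def blockSubgroup {X : Type u} [BraidedSet X] {n : ℕ} (s : Fin n → X) :
    Subgroup (Equiv.Perm (Fin n)) where
  carrier := {σ | ∀ c, σ '' block s c = block s c}
  one_mem' := by simp
  mul_mem' := by
    intro a b ha hb c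
    rw [Equiv.Perm.coe_mul, Set.image_comp, hb c, ha c]
  inv_mem' := by
    intro a ha c
    conv_lhs => rw [← ha c]
    rw [← Set.image_comp, ← Equiv.Perm.coe_mul]
    simp

theorem component_apply_of_mem {X : Type u} [BraidedSet X] {n : ℕ} {s : Fin n → X}
    {σ : Equiv.Perm (Fin n)} (h : σ ∈ blockSubgroup s) (i : Fin n) :
    component (s (σ i)) = component (s i) := by
  have h1 : σ i ∈ σ '' block s (component (s i)) := ⟨i, rfl, rfl⟩
  rw [h] at h1
  exact h1

/-- The identification of `{σ ∈ S_n | σ(D_c) = D_c for all c}` with the direct product of the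
symmetric groups of the sets `D_c`, by restriction of `σ` to each `D_c`. -/
def blockEquiv {X : Type u} [BraidedSet X] {n : ℕ} (s : Fin n → X) :
    blockSubgroup s ≃* ((c : Component X) → Equiv.Perm (block s c)) where
  toFun σ c := σ.1.subtypePerm fun i => by
    change component (s (σ.1 i)) = c ↔ component (s i) = c
    rw [component_apply_of_mem σ.2]
  invFun τ :=
    ⟨{ toFun := fun i => (τ (component (s i)) ⟨i, rfl⟩ : Fin n)
       invFun := fun i => ((τ (component (s i))).symm ⟨i, rfl⟩ : Fin n)
       left_inv := by
         intro i
         have key : ∀ (c : Component X) (j : block s c),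
             ((τ (component (s (τ c j).1))).symm ⟨(τ c j).1, rfl⟩ : Fin n) = j := by
           rintro c j
           have hc : component (s (τ c j).1) = c := (τ c j).2
           have : ∀ (d : Component X) (hd : component (s (τ c j).1) = d),
               d = c → ((τ d).symm ⟨(τ c j).1, hd⟩ : Fin n) = j := by
             rintro d hd rfl
             exact congrArg Subtype.val ((τ d).symm_apply_apply j)
           exact this _ rfl hc
         exact key _ ⟨i, rfl⟩
       right_inv := by
         intro i
         have key : ∀ (c : Component X) (j : block s c),
             (τ (component (s ((τ c).symm j).1)) ⟨((τ c).symm j).1, rfl⟩ : Fin n) = j := by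
           rintro c j
           have hc : component (s ((τ c).symm j).1) = c := ((τ c).symm j).2
           have : ∀ (d : Component X) (hd : component (s ((τ c).symm j).1) = d),
               d = c → (τ d ⟨((τ c).symm j).1, hd⟩ : Fin n) = j := by
             rintro d hd rfl
             exact congrArg Subtype.val ((τ d).apply_symm_apply j)
           exact this _ rfl hc
         exact key _ ⟨i, rfl⟩ }, by
      intro c
      apply Set.eq_of_subset_of_ncard_le
      · rintro _ ⟨i, hi, rfl⟩
        have hi' : component (s i) = c := hi
        subst hi'
        exact (τ (component (s i)) ⟨i, rfl⟩).2
      · rw [Set.ncard_image_of_injective _ (Equiv.injective _)]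
      · exact Set.toFinite _⟩
  left_inv σ := by ext i; rfl
  right_inv τ := by
    funext c
    ext ⟨i, hi⟩
    have hi' : component (s i) = c := hi
    subst hi'
    rfl
  map_mul' σ τ := by funext c; ext i; rfl

open Classical in
/-- The direct product of the alternating groups of the sets `D_c`. -/
noncomputable def alternatingProduct {X : Type u} [BraidedSet X] {n : ℕ} (s : Fin n → X) :
    Subgroup ((c : Component X) → Equiv.Perm (block s c)) :=
  Subgroup.pi Set.univ fun c => alternatingGroup (block s c)

/-- The colored braid group of `s`: the inverse image in `B_n` of the subgroup
`{σ | σ(D_c) = D_c for all c}` of `S_n`. -/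
def coloredBraidGroup {X : Type u} [BraidedSet X] {n : ℕ} (s : Fin n → X) :
    Subgroup (BraidGroup n) :=
  (blockSubgroup s).comap (braidToPerm n)

/-- The homomorphism from the colored braid group of `s` to the direct product of the symmetric
groups of the sets `D_c`. -/
def coloredBraidToPerm {X : Type u} [BraidedSet X] {n : ℕ} (s : Fin n → X) :
    coloredBraidGroup s →* ((c : Component X) → Equiv.Perm (block s c)) :=
  (blockEquiv s).toMonoidHom.comp
    ((braidToPerm n).subgroupComap (blockSubgroup s))

end Braided

/-! Attach a label to each strand. A braid stabilizes `s` and induces `τ` exactly when it restores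
all the colours while permuting the labels by `τ`, so it suffices to realize three-cycles of labels
inside each block: these generate the alternating groups.

Three adjacent strands of one colour `y` can be rotated (`BraidEquiv.rotate_three`). In a quandle
`σ₁σ₂` would do; in a rack `y ^ y` may differ from `y`, and a longer word restores the colours.

To bring equal colours together, let `r` be a multiple of the orders of all the maps `x ↦ x ^ y`. A
block of `r` strands of one colour slides past any strand without changing it, and each strand it
passes under instead recolours the whole block. Hence the block can take any colour in its orbit
under the group generated by the remaining strands (`BraidEquiv.monochrome_recolour`). If a
component occurs often enough, some colour `x` in it occurs more than `r` times. The strands outside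
a block of `r` of them still generate the full group, which is transitive on the component, so the
block can be recoloured to match any strand of that component and moved next to it. This puts every
label of the component in a three-cycle with a fixed label `a` (`exists_linked`), and overlapping
three-cycles produce all the others (`Linked.cyc_mem`).

The stabilizer lies in the colored braid group because crossings preserve components. -/

namespace Braided

open Equiv Equiv.Perm

/-! ### Moves on coloured, labelled strands -/

section Strands

variable {X α β : Type*} {φ : X → Equiv.Perm X}

/-- One positive crossing in a list of labelled strands `(colour, label)`: the strand that crosses
under `y` has its colour changed by `φ y`. -/
inductive Crossing (φ : X → Equiv.Perm X) : List (X × α) → List (X × α) → Prop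
  | mk (u v : List (X × α)) (x y : X) (a b : α) :
      Crossing φ (u ++ (x, a) :: (y, b) :: v) (u ++ (y, b) :: (φ y x, a) :: v)

/-- The equivalence relation on lists of labelled strands generated by crossings. -/
def BraidEquiv (φ : X → Equiv.Perm X) : List (X × α) → List (X × α) → Prop :=
  Relation.EqvGen (Crossing φ)

namespace BraidEquiv

theorem refl (l : List (X × α)) : BraidEquiv φ l l := Relation.EqvGen.refl l

theorem symm {l l' : List (X × α)} (h : BraidEquiv φ l l') : BraidEquiv φ l' l :=
  Relation.EqvGen.symm _ _ h

theorem trans {l l' l'' : List (X × α)} (h : BraidEquiv φ l l') (h' : BraidEquiv φ l' l'') :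
    BraidEquiv φ l l'' :=
  Relation.EqvGen.trans _ _ _ h h'

theorem append {l l' : List (X × α)} (h : BraidEquiv φ l l') (u v : List (X × α)) :
    BraidEquiv φ (u ++ l ++ v) (u ++ l' ++ v) := by
  induction h with
  | rel _ _ h =>
    obtain ⟨u', v', x, y, a, b⟩ := h
    have := Crossing.mk (φ := φ) (u ++ u') (v' ++ v) x y a b
    exact Relation.EqvGen.rel _ _ (by simpa using this)
  | refl => exact refl _
  | symm _ _ _ ih => exact ih.symm
  | trans _ _ _ _ _ ih ih' => exact ih.trans ih'

theorem append_left {l l' : List (X × α)} (u : List (X × α)) (h : BraidEquiv φ l l') :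
    BraidEquiv φ (u ++ l) (u ++ l') := by
  simpa using h.append u []

theorem append_right {l l' : List (X × α)} (h : BraidEquiv φ l l') (v : List (X × α)) :
    BraidEquiv φ (l ++ v) (l' ++ v) :=
  h.append [] v

theorem cross (x y : X) (a b : α) :
    BraidEquiv φ [(x, a), (y, b)] [(y, b), (φ y x, a)] :=
  Relation.EqvGen.rel _ _ (Crossing.mk [] [] x y a b)

/-- Crossings are compatible with a change of labels. -/
theorem map_labels {l l' : List (X × α)} (f : α → β) (h : BraidEquiv φ l l') :
    BraidEquiv φ (l.map (Prod.map id f)) (l'.map (Prod.map id f)) := by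
  induction h with
  | rel _ _ h =>
    obtain ⟨u, v, x, y, a, b⟩ := h
    have := Crossing.mk (φ := φ) (u.map (Prod.map id f)) (v.map (Prod.map id f)) x y (f a) (f b)
    exact Relation.EqvGen.rel _ _ (by simpa using this)
  | refl => exact refl _
  | symm _ _ _ ih => exact ih.symm
  | trans _ _ _ _ _ ih ih' => exact ih.trans ih'

theorem labels_perm {l l' : List (X × α)} (h : BraidEquiv φ l l') :
    (l.map Prod.snd).Perm (l'.map Prod.snd) := by
  induction h with
  | rel _ _ h =>
    obtain ⟨u, v, x, y, a, b⟩ := h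
    simpa using List.Perm.append_left _ (List.Perm.swap _ _ _)
  | refl => exact List.Perm.refl _
  | symm _ _ _ ih => exact ih.symm
  | trans _ _ _ _ _ ih ih' => exact ih.trans ih'

theorem length_eq {l l' : List (X × α)} (h : BraidEquiv φ l l') : l.length = l'.length := by
  simpa using h.labels_perm.length_eq

/-- A property of strands that is unaffected by the changes of colours is preserved. -/
theorem forall_mem_iff {l l' : List (X × α)} (P : X → α → Prop)
    (hP : ∀ x y a, P (φ y x) a ↔ P x a) (h : BraidEquiv φ l l') :
    (∀ p ∈ l, P p.1 p.2) ↔ ∀ p ∈ l', P p.1 p.2 := by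
  induction h with
  | rel _ _ h =>
    obtain ⟨u, v, x, y, a, b⟩ := h
    simp only [List.mem_append, List.mem_cons, or_imp, forall_and, forall_eq, hP]
    tauto
  | refl => exact Iff.rfl
  | symm _ _ _ ih => exact ih.symm
  | trans _ _ _ _ _ ih ih' => exact ih.trans ih'

end BraidEquiv

/-- The group generated by the permutations attached to the colours of a list of strands. -/
def colourGroup (φ : X → Equiv.Perm X) (l : List (X × α)) : Subgroup (Equiv.Perm X) :=
  Subgroup.closure {g | ∃ p ∈ l, φ p.1 = g}

theorem mem_colourGroup {l : List (X × α)} {p : X × α} (hp : p ∈ l) :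
    φ p.1 ∈ colourGroup φ l :=
  Subgroup.subset_closure ⟨p, hp, rfl⟩

theorem colourGroup_le_iff {l : List (X × α)} {G : Subgroup (Equiv.Perm X)} :
    colourGroup φ l ≤ G ↔ ∀ p ∈ l, φ p.1 ∈ G := by
  simp only [colourGroup, Subgroup.closure_le]
  constructor
  · exact fun h p hp => h ⟨p, hp, rfl⟩
  · rintro h _ ⟨p, hp, rfl⟩
    exact h p hp

/-- A crossing keeps `φ y` and replaces `φ x` by its conjugate under `φ y`; either pair generates
the same group. -/
theorem BraidEquiv.colourGroup_eq (hφ : ∀ x y, φ (φ y x) = φ y * φ x * (φ y)⁻¹)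
    {l l' : List (X × α)} (h : BraidEquiv φ l l') : colourGroup φ l = colourGroup φ l' := by
  induction h with
  | rel _ _ h =>
    obtain ⟨u, v, x, y, a, b⟩ := h
    apply le_antisymm
    · rw [colourGroup_le_iff]
      intro p hp
      simp only [List.mem_append, List.mem_cons] at hp
      rcases hp with hp | rfl | rfl | hp
      · exact mem_colourGroup (by simp [hp])
      · have h1 : φ y ∈ colourGroup φ (u ++ (y, b) :: (φ y x, a) :: v) :=
          mem_colourGroup (p := (y, b)) (by simp)
        have h2 : φ (φ y x) ∈ colourGroup φ (u ++ (y, b) :: (φ y x, a) :: v) :=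
          mem_colourGroup (p := (φ y x, a)) (by simp)
        have h3 : φ x = (φ y)⁻¹ * φ (φ y x) * φ y := by rw [hφ]; group
        change φ x ∈ _
        rw [h3]
        exact mul_mem (mul_mem (inv_mem h1) h2) h1
      · exact mem_colourGroup (by simp)
      · exact mem_colourGroup (by simp [hp])
    · rw [colourGroup_le_iff]
      intro p hp
      simp only [List.mem_append, List.mem_cons] at hp
      rcases hp with hp | rfl | rfl | hp
      · exact mem_colourGroup (by simp [hp])
      · exact mem_colourGroup (by simp)
      · have h1 : φ y ∈ colourGroup φ (u ++ (x, a) :: (y, b) :: v) :=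
          mem_colourGroup (p := (y, b)) (by simp)
        have h2 : φ x ∈ colourGroup φ (u ++ (x, a) :: (y, b) :: v) :=
          mem_colourGroup (p := (x, a)) (by simp)
        change φ (φ y x) ∈ _
        rw [hφ]
        exact mul_mem (mul_mem h1 h2) (inv_mem h1)
      · exact mem_colourGroup (by simp [hp])
  | refl => rfl
  | symm _ _ _ ih => exact ih.symm
  | trans _ _ _ _ _ ih ih' => exact ih.trans ih'

/-- The strands with labels in `A`, all of them of colour `x`. -/
def monochrome (x : X) (A : List α) : List (X × α) := A.map (Prod.mk x)

@[simp] theorem monochrome_nil (x : X) : monochrome x ([] : List α) = [] := rfl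

@[simp] theorem monochrome_cons (x : X) (a : α) (A : List α) :
    monochrome x (a :: A) = (x, a) :: monochrome x A := rfl

@[simp] theorem monochrome_append (x : X) (A B : List α) :
    monochrome x (A ++ B) = monochrome x A ++ monochrome x B := List.map_append

@[simp] theorem map_snd_monochrome (x : X) (A : List α) :
    (monochrome x A).map Prod.snd = A := by
  simp [monochrome, Function.comp_def]

namespace BraidEquiv

/-- A strand passes a monochrome block from left to right. -/
theorem cons_monochrome (x y : X) (a : α) (A : List α) :
    BraidEquiv φ ((x, a) :: monochrome y A) (monochrome y A ++ [((φ y ^ A.length) x, a)]) := by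
  induction A generalizing x with
  | nil => simpa using refl _
  | cons b A ih =>
    have h1 := (cross (φ := φ) x y a b).append_right (monochrome y A)
    have h2 := (ih (φ y x)).append_left [(y, b)]
    refine h1.trans ?_
    simpa [pow_succ, Perm.mul_apply] using h2

/-- A monochrome block passes a strand from left to right. -/
theorem monochrome_append_singleton (x y : X) (a : α) (A : List α) :
    BraidEquiv φ (monochrome x A ++ [(y, a)]) ((y, a) :: monochrome (φ y x) A) := by
  induction A with
  | nil => exact refl _
  | cons b A ih =>
    have h1 := ih.append_left [(x, b)]
    have h2 := (cross (φ := φ) x y b a).append_right (monochrome (φ y x) A)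
    exact h1.trans h2

/-- A monochrome block whose total action is trivial commutes with everything. -/
theorem monochrome_comm {x : X} {A : List α} (hA : φ x ^ A.length = 1) (l : List (X × α)) :
    BraidEquiv φ (l ++ monochrome x A) (monochrome x A ++ l) := by
  induction l with
  | nil => simpa using refl _
  | cons p l ih =>
    obtain ⟨y, a⟩ := p
    have h1 := ih.append_left [(y, a)]
    have h2 := (cons_monochrome (φ := φ) y x a A).append_right l
    rw [hA] at h2
    refine h1.trans ?_
    simpa using h2

/-- A monochrome block whose total action is trivial can be recoloured by the group generated by
the other strands. -/
theorem monochrome_recolour {r : ℕ} (hr : ∀ x, φ x ^ r = 1) {A : List α} (hA : A.length = r)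
    (l : List (X × α)) {g : Equiv.Perm X} (hg : g ∈ colourGroup φ l) (x : X) :
    BraidEquiv φ (monochrome x A ++ l) (monochrome (g x) A ++ l) := by
  induction hg using Subgroup.closure_induction generalizing x with
  | mem g hg =>
    obtain ⟨⟨y, a⟩, hp, rfl⟩ := hg
    obtain ⟨u, v, rfl⟩ := List.append_of_mem hp
    have hA' : ∀ z, φ z ^ A.length = 1 := fun z => hA ▸ hr z
    -- The block slides right through `u`, crosses under `y` and is recoloured, then slides back;
    -- all other strands return to their places and colours.
    have h1 := ((monochrome_comm (hA' x) u).symm).append_right ((y, a) :: v)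
    have h2 := (monochrome_append_singleton (φ := φ) x y a A).append u v
    have h3 := (monochrome_comm (hA' (φ y x)) (u ++ [(y, a)])).append_right v
    simp only [List.append_assoc, List.cons_append, List.nil_append] at h1 h2 h3
    exact (h1.trans h2).trans h3
  | one => exact refl _
  | mul g h _ _ ihg ihh => exact (ihh x).trans (ihg (h x))
  | inv g _ ih => simpa using (ih (g⁻¹ x)).symm

/-- All the strands of colour `x` can be moved to the left. -/
theorem exists_monochrome_append [DecidableEq X] (x : X) (l : List (X × α)) :
    ∃ t, BraidEquiv φ l (monochrome x ((l.filter fun p => p.1 = x).map Prod.snd) ++ t) ∧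
      t.map Prod.snd = (l.filter fun p => p.1 ≠ x).map Prod.snd := by
  induction l with
  | nil => exact ⟨[], refl _, rfl⟩
  | cons p l ih =>
    obtain ⟨y, a⟩ := p
    obtain ⟨t, ht, ht'⟩ := ih
    by_cases hy : y = x
    · subst hy
      refine ⟨t, ?_, by simpa using ht'⟩
      simpa using ht.append_left [(y, a)]
    · refine ⟨((φ x ^ ((l.filter fun p => p.1 = x).map Prod.snd).length) y, a) :: t, ?_, ?_⟩
      · have h1 := ht.append_left [(y, a)]
        have h2 := (cons_monochrome (φ := φ) y x a
          ((l.filter fun p => p.1 = x).map Prod.snd)).append_right t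
        have h3 := h1.trans h2
        simp only [List.append_assoc, List.cons_append, List.nil_append] at h3
        simpa [hy] using h3
      · simpa [hy] using ht'

/-- Three strands of the same colour can be permuted cyclically. -/
theorem rotate_three (hφ : ∀ x y, φ (φ y x) = φ y * φ x * (φ y)⁻¹) (y : X) (a b c : α) :
    BraidEquiv φ [(y, a), (y, b), (y, c)] [(y, b), (y, c), (y, a)] := by
  set e := φ y with he
  -- The colours `e ^ k y` all act as `e`, so crossing under any of them just raises the exponent by
  -- one; only the exponents need tracking.
  have hz : ∀ k : ℤ, φ ((e ^ k) y) = e := by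
    have hpos : ∀ z, φ z = e → φ (e z) = e := by
      intro z hz
      rw [he, hφ, hz, ← he]; group
    have hneg : ∀ z, φ z = e → φ (e⁻¹ z) = e := by
      intro z hz
      have h := hφ (e⁻¹ z) y
      rw [← he, ← Perm.mul_apply, mul_inv_cancel, Perm.one_apply, hz] at h
      have h' : φ (e⁻¹ z) = e⁻¹ * (e * φ (e⁻¹ z) * e⁻¹) * e := by group
      rw [h', ← h]; group
    intro k
    induction k using Int.induction_on with
    | zero => exact he.symm
    | succ k ih =>
      have := hpos _ ih
      rwa [← Perm.mul_apply, ← zpow_one_add, add_comm] at this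
    | pred k ih =>
      have := hneg _ ih
      rwa [← Perm.mul_apply, ← zpow_neg_one, ← zpow_add, add_comm] at this
  have cr : ∀ (i j i' : ℤ) (_ : i + 1 = i') (a b : α),
      BraidEquiv φ [((e ^ i) y, a), ((e ^ j) y, b)] [((e ^ j) y, b), ((e ^ i') y, a)] := by
    rintro i j _ rfl a b
    have h := cross (φ := φ) ((e ^ i) y) ((e ^ j) y) a b
    rwa [hz, ← Perm.mul_apply, ← zpow_one_add, add_comm] at h
  have s1 : ∀ (i j i' k : ℤ) (_ : i + 1 = i') (a b c : α),
      BraidEquiv φ [((e ^ i) y, a), ((e ^ j) y, b), ((e ^ k) y, c)]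
        [((e ^ j) y, b), ((e ^ i') y, a), ((e ^ k) y, c)] :=
    fun i j i' k h a b c => (cr i j i' h a b).append_right [((e ^ k) y, c)]
  have s2 : ∀ (k i j i' : ℤ) (_ : i + 1 = i') (c a b : α),
      BraidEquiv φ [((e ^ k) y, c), ((e ^ i) y, a), ((e ^ j) y, b)]
        [((e ^ k) y, c), ((e ^ j) y, b), ((e ^ i') y, a)] :=
    fun k i j i' h c a b => (cr i j i' h a b).append_left [((e ^ k) y, c)]
  -- The word is `σ₁σ₂⁻¹σ₁³σ₂⁻²σ₁⁻¹`: each strand crosses under others positively as often as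
  -- negatively, so all exponents return to `0`.
  have h := (s1 0 0 1 0 rfl a b c).trans <|
    (s2 0 (-1) 1 0 rfl b c a).symm.trans <|
    (s1 0 (-1) 1 1 rfl b c a).trans <|
    (s1 (-1) 1 0 1 rfl c b a).trans <|
    (s1 1 0 2 1 rfl b c a).trans <|
    (s2 0 0 2 1 rfl c a b).symm.trans <|
    (s2 0 1 0 2 rfl c b a).symm.trans
    (s1 0 0 1 0 rfl b c a).symm
  simpa using h

end BraidEquiv

end Strands

/-! ### Groups generated by overlapping three-cycles -/

section ThreeCycles

variable {α : Type*}

/-- If all consecutive triples of a list of length at least three consist of related elements,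
then all the elements of the list are related to the first one. -/
theorem rel_head_of_triples {r : α → α → Prop} (hr : ∀ a, r a a)
    (ht : ∀ a b c, r a b → r b c → r a c) (Q : List α) : ∀ a b c : α,
    (∀ P x y z R, a :: b :: c :: Q = P ++ x :: y :: z :: R → r x y ∧ r y z) →
    ∀ e ∈ a :: b :: c :: Q, r a e := by
  induction Q with
  | nil =>
    intro a b c h e he
    have := h [] a b c [] rfl
    simp only [List.mem_cons, List.not_mem_nil, or_false] at he
    rcases he with rfl | rfl | rfl
    · exact hr _
    · exact this.1
    · exact ht _ _ _ this.1 this.2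
  | cons d Q ih =>
    intro a b c h e he
    rcases List.mem_cons.1 he with rfl | he
    · exact hr _
    · refine ht _ _ _ (h [] a b c (d :: Q) rfl).1 (ih b c d ?_ e he)
      intro P x y z R hP
      exact h (a :: P) x y z R (by rw [hP, List.cons_append])

variable [DecidableEq α]

/-- The permutation `a ↦ b ↦ c ↦ a`, a three-cycle if `a`, `b`, `c` are distinct. -/
def cyc (a b c : α) : Equiv.Perm α := swap a b * swap b c

theorem cyc_conj (g : Equiv.Perm α) (a b c : α) :
    g * cyc a b c * g⁻¹ = cyc (g a) (g b) (g c) := by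
  simp only [cyc, Equiv.swap_apply_apply]
  group

theorem cyc_rotate {a b c : α} (hab : a ≠ b) (hac : a ≠ c) (hbc : b ≠ c) :
    cyc b c a = cyc a b c := by
  ext z
  simp only [cyc, Perm.mul_apply, swap_apply_def]
  grind

theorem cyc_inv {a b c : α} (hab : a ≠ b) (hac : a ≠ c) (hbc : b ≠ c) :
    (cyc a b c)⁻¹ = cyc b a c := by
  rw [inv_eq_iff_mul_eq_one]
  ext z
  simp only [cyc, Perm.mul_apply, swap_apply_def, Perm.one_apply]
  grind

theorem cyc_apply {a b c : α} (hab : a ≠ b) (hac : a ≠ c) (hbc : b ≠ c) (z : α) :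
    cyc a b c z = if z = a then b else if z = b then c else if z = c then a else z := by
  simp only [cyc, Perm.mul_apply, swap_apply_def]
  grind

/-- Two elements are linked by a subgroup of permutations if they are equal, or occur together in
a three-cycle of the subgroup. -/
def Linked (H : Subgroup (Equiv.Perm α)) (a b : α) : Prop :=
  a = b ∨ ∃ c, a ≠ b ∧ a ≠ c ∧ b ≠ c ∧ cyc a b c ∈ H

namespace Linked

variable {H : Subgroup (Equiv.Perm α)}

theorem symm {a b : α} (h : Linked H a b) : Linked H b a := by
  rcases h with rfl | ⟨c, hab, hac, hbc, h⟩
  · exact Or.inl rfl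
  · exact Or.inr ⟨c, hab.symm, hbc, hac, by rw [← cyc_inv hab hac hbc]; exact inv_mem h⟩

theorem trans {a b c : α} (h : Linked H a b) (h' : Linked H b c) : Linked H a c := by
  rcases h with rfl | ⟨k, hab, hak, hbk, h⟩
  · exact h'
  rcases h' with rfl | ⟨l, hbc, hbl, hcl, h'⟩
  · exact Or.inr ⟨k, hab, hak, hbk, h⟩
  by_cases hac : a = c
  · exact Or.inl hac
  by_cases hck : c = k
  · subst hck
    exact symm (Or.inr ⟨b, fun h => hac h.symm, hbk.symm, hab, by
      rwa [← cyc_rotate hak.symm hbk.symm hab]⟩)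
  · have hg : (cyc a b k)⁻¹ * cyc b c l * ((cyc a b k)⁻¹)⁻¹ ∈ H :=
      mul_mem (mul_mem (inv_mem h) h') (inv_mem (inv_mem h))
    have h1 : (cyc a b k)⁻¹ b = a := by
      rw [Perm.inv_eq_iff_eq, cyc_apply hab hak hbk]; simp
    have h2 : (cyc a b k)⁻¹ c = c := by
      rw [Perm.inv_eq_iff_eq, cyc_apply hab hak hbk]; simp [hbc.symm, hck, Ne.symm hac]
    rw [cyc_conj, h1, h2] at hg
    refine Or.inr ⟨_, hac, ?_, ?_, hg⟩
    · intro h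
      exact hbl ((cyc a b k)⁻¹.injective (h1.trans h))
    · intro h
      exact hcl ((cyc a b k)⁻¹.injective (h2.trans h))

/-- If the elements of a set are linked, then all three-cycles on the set are in the subgroup. -/
theorem cyc_mem {a b c : α} (hab : a ≠ b) (hac : a ≠ c) (hbc : b ≠ c)
    (h : Linked H a b) (h' : Linked H b c) : cyc a b c ∈ H := by
  obtain ⟨k, -, hak, hbk, hk⟩ := h.resolve_left hab
  by_cases hkc : k = c
  · rwa [← hkc]
  have hkb : Linked H k b := by
    refine symm (Or.inr ⟨a, hbk, hab.symm, hak.symm, ?_⟩)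
    rwa [cyc_rotate hab hak hbk]
  obtain ⟨q, -, hkq, hcq, hq⟩ := (hkb.trans h').resolve_left hkc
  -- Conjugating `cyc a b k` by `cyc k c q` replaces `k` by `c`, provided that `q` is neither `a`
  -- nor `b`. In those two cases conjugation by the inverse yields the three-cycle on `a, b, c` of
  -- opposite orientation.
  by_cases hqb : q = b
  · subst hqb
    have hg := mul_mem (mul_mem (inv_mem hq) hk) (inv_mem (inv_mem hq))
    rw [cyc_conj, cyc_inv hkc hkq hcq, cyc_apply (Ne.symm hkc) hcq hkq, cyc_apply (Ne.symm hkc) hcq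
      hkq, cyc_apply (Ne.symm hkc) hcq hkq] at hg
    simp only [hac, hak, hab, hbc, hbk, hkc, if_true, if_false] at hg
    rw [← inv_mem_iff, cyc_inv hac hab hbc.symm] at hg
    rwa [cyc_rotate hac.symm hbc.symm hab]
  by_cases hqa : q = a
  · subst hqa
    have hg := mul_mem (mul_mem (inv_mem hq) hk) (inv_mem (inv_mem hq))
    rw [cyc_conj, cyc_inv hkc hkq hcq, cyc_apply (Ne.symm hkc) hcq hkq, cyc_apply (Ne.symm hkc) hcq
      hkq, cyc_apply (Ne.symm hkc) hcq hkq] at hg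
    simp only [hac, hak, hab.symm, hbc, hbk, hkc, if_true, if_false] at hg
    rw [← inv_mem_iff, cyc_inv hbc.symm hac.symm hab.symm] at hg
    rwa [← cyc_rotate hab hac hbc]
  · have hg := mul_mem (mul_mem hq hk) (inv_mem hq)
    rw [cyc_conj, cyc_apply hkc hkq hcq, cyc_apply hkc hkq hcq, cyc_apply hkc hkq hcq] at hg
    simpa only [hac, hak, Ne.symm hqa, hbc, hbk, Ne.symm hqb, if_true, if_false] using hg

end Linked

end ThreeCycles

/-! ### Label permutations realized by crossings -/

section LabelGroup

variable {X α : Type*} {φ : X → Equiv.Perm X}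

/-- The group of the permutations of the labels that can be realized by crossings. -/
def labelGroup (φ : X → Equiv.Perm X) (l : List (X × α)) : Subgroup (Equiv.Perm α) where
  carrier := {τ | BraidEquiv φ (l.map (Prod.map id τ)) l}
  one_mem' := by simpa using BraidEquiv.refl l
  mul_mem' := by
    intro σ τ hσ hτ
    have h := (BraidEquiv.map_labels σ hτ).trans hσ
    rw [List.map_map] at h
    exact h
  inv_mem' := by
    intro σ hσ
    have h := (BraidEquiv.map_labels (σ⁻¹ : Equiv.Perm α) hσ).symm
    rw [List.map_map] at h
    have hid : Prod.map id (σ⁻¹ : Equiv.Perm α) ∘ Prod.map id σ = (id : X × α → X × α) := by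
      ext p <;> simp
    rw [hid, List.map_id] at h
    exact h

theorem mem_labelGroup {l : List (X × α)} {τ : Equiv.Perm α} :
    τ ∈ labelGroup φ l ↔ BraidEquiv φ (l.map (Prod.map id τ)) l := Iff.rfl

variable [DecidableEq α]

/-- The labels are distinct, so relabelling by `cyc a b c` only affects the displayed triple, where
`BraidEquiv.rotate_three` undoes it. -/
theorem cyc_mem_labelGroup (hφ : ∀ x y, φ (φ y x) = φ y * φ x * (φ y)⁻¹)
    {l : List (X × α)} (hl : (l.map Prod.snd).Nodup) {P Q : List (X × α)} {y : X} {a b c : α}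
    (h : BraidEquiv φ l (P ++ (y, a) :: (y, b) :: (y, c) :: Q)) :
    (a ≠ b ∧ a ≠ c ∧ b ≠ c) ∧ cyc a b c ∈ labelGroup φ l := by
  have hnd := h.labels_perm.nodup_iff.1 hl
  simp only [List.map_append, List.map_cons, List.nodup_append, List.nodup_cons, List.mem_cons,
    not_or] at hnd
  obtain ⟨-, ⟨⟨hab, hac, haQ⟩, ⟨hbc, hbQ⟩, hcQ, -⟩, hP⟩ := hnd
  have hba : b ≠ a := Ne.symm hab
  have hca : c ≠ a := Ne.symm hac
  have hcb : c ≠ b := Ne.symm hbc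
  refine ⟨⟨hab, hac, hbc⟩, ?_⟩
  have hfix : ∀ R : List (X × α), (∀ p ∈ R, p.2 ≠ a ∧ p.2 ≠ b ∧ p.2 ≠ c) →
      R.map (Prod.map id (cyc a b c)) = R := by
    intro R hR
    conv_rhs => rw [← List.map_id R]
    refine List.map_congr_left fun p hp => ?_
    obtain ⟨h1, h2, h3⟩ := hR p hp
    ext <;> simp [cyc_apply hab hac hbc, h1, h2, h3]
  have hP' := hfix P fun p hp =>
    have := hP p.2 (List.mem_map_of_mem hp)
    ⟨this a (by simp), this b (by simp), this c (by simp)⟩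
  have hQ' := hfix Q fun p hp =>
    have := List.mem_map_of_mem (f := Prod.snd) hp
    ⟨fun e => haQ (e ▸ this), fun e => hbQ (e ▸ this), fun e => hcQ (e ▸ this)⟩
  have h1 := BraidEquiv.map_labels (cyc a b c) h
  simp only [List.map_append, List.map_cons, hP', hQ', Prod.map, id, cyc_apply hab hac hbc] at h1
  simp only [if_true, hba, hca, hcb, if_false] at h1
  have h2 := (BraidEquiv.rotate_three hφ y a b c).append P Q
  simp only [List.append_assoc, List.cons_append, List.nil_append] at h2
  exact (h1.trans h2.symm).trans h.symm

/-- If sufficiently many strands have the same colour `x`, and the colours generate, then the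
labels of all the strands with a colour in the orbit of `x` are linked to each other. -/
theorem exists_linked [DecidableEq X] (hφ : ∀ x y, φ (φ y x) = φ y * φ x * (φ y)⁻¹)
    {r : ℕ} (hr : ∀ x, φ x ^ r = 1) (hr2 : 2 ≤ r) {l : List (X × α)}
    (hl : (l.map Prod.snd).Nodup) (hgen : ∀ y, φ y ∈ colourGroup φ l) (x : X)
    (hx : r < (l.filter fun p => p.1 = x).length) :
    ∃ a, ∀ p ∈ l, (∃ g ∈ colourGroup φ l, g x = p.1) → Linked (labelGroup φ l) a p.2 := by
  obtain ⟨t, ht, ht'⟩ := BraidEquiv.exists_monochrome_append (φ := φ) x l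
  set A := (l.filter fun p => p.1 = x).map Prod.snd with hA
  have hAl : r < A.length := by simpa [hA] using hx
  -- Split off a block of exactly `r` strands; the nonempty rest `A₂` keeps the colour `x` present
  -- outside it.
  obtain ⟨a, b, A₁, A₂, hA₁, hA₂, hA₁₂⟩ : ∃ a b A₁ A₂, (a :: b :: A₁).length = r ∧ A₂ ≠ [] ∧
      A = (a :: b :: A₁) ++ A₂ := by
    have h1 : (A.take r).length = r := by simp; omega
    have h2 : A.drop r ≠ [] := by simp; omega
    match hA' : A.take r, h1 with
    | [], h1 => simp at h1; omega
    | [_], h1 => simp at h1; omega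
    | a :: b :: A₁, h1 => exact ⟨a, b, A₁, _, h1, h2, by rw [← hA', List.take_append_drop]⟩
  obtain ⟨c, A₃, hA₃⟩ : ∃ c A₃, A = a :: b :: c :: A₃ := by
    match A₁, A₂, hA₂ with
    | c :: A₁, A₂, _ => exact ⟨c, A₁ ++ A₂, by rw [hA₁₂]; rfl⟩
    | [], c :: A₂, _ => exact ⟨c, A₂, by rw [hA₁₂]; rfl⟩
  have hhub : ∀ e ∈ A, Linked (labelGroup φ l) a e := by
    rw [hA₃]
    refine rel_head_of_triples (r := Linked (labelGroup φ l)) (fun _ => Or.inl rfl)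
      (fun _ _ _ h h' => Linked.trans h h') A₃ a b c ?_
    intro P i j k R hP
    rw [hA₃, hP] at ht
    simp only [monochrome_append, monochrome_cons, List.append_assoc, List.cons_append] at ht
    obtain ⟨⟨hij, hik, hjk⟩, hmem⟩ := cyc_mem_labelGroup hφ hl ht
    exact ⟨Or.inr ⟨k, hij, hik, hjk, hmem⟩,
      Or.inr ⟨i, hjk, hij.symm, hik.symm, by rwa [cyc_rotate hij hik hjk]⟩⟩
  refine ⟨a, fun p hp hpx => ?_⟩
  by_cases hpx' : p.1 = x
  · exact hhub _ (List.mem_map_of_mem (by simp [hp, hpx']))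
  set G := colourGroup φ l with hG
  obtain ⟨q, hq, hqp⟩ : ∃ q ∈ t, q.2 = p.2 := by
    have : p.2 ∈ t.map Prod.snd := by
      rw [ht']; exact List.mem_map_of_mem (by simp [hp, hpx'])
    simpa using this
  obtain ⟨g, hg, hgx⟩ : ∃ g ∈ G, g x = q.1 := by
    -- Gathering the strands of colour `x` may have changed the colour of the strand labelled `p.2`,
    -- but not the `G`-orbit of that colour.
    have key := (BraidEquiv.forall_mem_iff (φ := φ)
      (fun z i => i = p.2 → ∃ g ∈ G, g x = z) ?_ ht).1 ?_
    · exact key q (by simp [hq]) hqp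
    · intro z y i
      refine forall_congr' fun _ => ⟨?_, ?_⟩
      · rintro ⟨g, hg, h⟩
        exact ⟨(φ y)⁻¹ * g, mul_mem (inv_mem (hgen y)) hg, by simp [h]⟩
      · rintro ⟨g, hg, h⟩
        exact ⟨φ y * g, mul_mem (hgen y) hg, by simp [h]⟩
    · intro p' hp' hpp
      rwa [List.inj_on_of_nodup_map hl hp' hp hpp]
  -- Removing the block loses no colour, since `A₂` still contributes `x`.
  have hG' : G ≤ colourGroup φ (monochrome x A₂ ++ t) := by
    rw [hG, ht.colourGroup_eq hφ, hA₁₂, colourGroup_le_iff]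
    intro p' hp'
    obtain ⟨d, A₂', rfl⟩ := List.exists_cons_of_ne_nil hA₂
    simp only [monochrome_append, List.append_assoc] at hp'
    rcases List.mem_append.1 hp' with h | h
    · obtain ⟨i, -, rfl⟩ := List.mem_map.1 h
      exact mem_colourGroup (p := (x, d)) (by simp)
    · exact mem_colourGroup h
  obtain ⟨u, v, huv⟩ := List.append_of_mem (l := monochrome x A₂ ++ t) (a := q) (by simp [hq])
  -- The block takes the colour of `q` and moves just to its right, so that `q`, `a`, `b` become
  -- adjacent strands of one colour.
  have h1 := BraidEquiv.monochrome_recolour hr hA₁ (monochrome x A₂ ++ t) (hG' hg) x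
  rw [hgx] at h1
  have h2 := (BraidEquiv.monochrome_comm (φ := φ) (x := q.1) (A := a :: b :: A₁)
    (hA₁ ▸ hr q.1) (u ++ [q])).symm.append_right v
  rw [hA₁₂, monochrome_append, List.append_assoc] at ht
  have h3 := ht.trans h1
  rw [huv] at h3
  simp only [List.append_assoc, List.cons_append, List.nil_append] at h2 h3
  have h4 := h3.trans h2
  rw [monochrome_cons, monochrome_cons] at h4
  obtain ⟨⟨hij, hik, hjk⟩, hmem⟩ := cyc_mem_labelGroup (y := q.1) (a := q.2) hφ hl h4
  simp only [hqp] at hij hik hjk hmem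
  exact Linked.symm (Or.inr ⟨b, hij, hik, hjk, hmem⟩)

end LabelGroup

/-! ### Finite racks and their inner permutations -/

section Rack

variable {X : Type*} [BraidedSet X]

theorem right_injective (hsd : IsSelfDistributive X) (y : X) :
    Function.Injective fun x : X => (BraidedSet.R (x, y)).2 := by
  intro x x' h
  have : (x, y) = (x', y) :=
    BraidedSet.R.injective (Prod.ext ((hsd x y).trans (hsd x' y).symm) h)
  exact congrArg Prod.fst this

/-- The permutation `x ↦ x ^ y` of a finite rack. -/
noncomputable def act [Finite X] (hsd : IsSelfDistributive X) (y : X) : Equiv.Perm X :=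
  Equiv.ofBijective _ (Finite.injective_iff_bijective.1 (right_injective hsd y))

variable [Finite X] (hsd : IsSelfDistributive X)

theorem R_eq (x y : X) : BraidedSet.R (x, y) = (y, act hsd y x) :=
  Prod.ext (hsd x y) rfl

/-- This is the third coordinate of the Yang–Baxter equation, `(z ^ x) ^ y = (z ^ y) ^ (x ^ y)`. -/
theorem act_act (x y : X) : act hsd (act hsd y x) = act hsd y * act hsd x * (act hsd y)⁻¹ := by
  rw [eq_mul_inv_iff_mul_eq]
  ext z
  have h := congrFun (BraidedSet.yang_baxter (X := X)) (z, x, y)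
  simp only [Function.comp, onFirstTwo, onLastTwo, R_eq hsd] at h
  exact (congrArg (fun p => p.2.2) h).symm

theorem component_act (x y : X) : component (act hsd y x) = component x :=
  Quotient.sound <| Relation.EqvGen.symm _ _ <| Relation.EqvGen.rel _ _
    ⟨x, y, y, act hsd y x, R_eq hsd x y, Or.inl ⟨rfl, rfl⟩⟩

/-- A group that contains all the permutations `act y` is transitive on the components. -/
theorem exists_mem_apply_eq {G : Subgroup (Equiv.Perm X)} (hG : ∀ y, act hsd y ∈ G) {x x' : X}
    (h : component x = component x') : ∃ g ∈ G, g x = x' := by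
  have h' : Relation.EqvGen _ x x' := Quotient.exact h
  induction h' with
  | rel a b hab =>
    obtain ⟨x, y, z, w, hR, ⟨rfl, rfl⟩ | ⟨rfl, rfl⟩⟩ := hab
    · rw [R_eq hsd] at hR
      exact ⟨_, hG y, congrArg Prod.snd hR⟩
    · rw [R_eq hsd] at hR
      exact ⟨1, one_mem _, congrArg Prod.fst hR⟩
  | refl a => exact ⟨1, one_mem _, rfl⟩
  | symm a b _ ih =>
    obtain ⟨g, hg, rfl⟩ := ih h.symm
    exact ⟨g⁻¹, inv_mem hg, by simp⟩
  | trans a b c hab hbc ih ih' =>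
    have h1 : component a = component b := Quotient.sound hab
    obtain ⟨g, hg, rfl⟩ := ih h1
    obtain ⟨g', hg', rfl⟩ := ih' (h1.symm.trans h)
    exact ⟨g' * g, mul_mem hg' hg, rfl⟩

/-- Self-distributivity makes `act` turn the rack operation into conjugation, under which `G` is
closed. This is how generation of `X` passes to groups: once `G` contains `act` of the generators,
it contains every `act y`. -/
theorem isBraidedSubset_act_mem (G : Subgroup (Equiv.Perm X)) :
    IsBraidedSubset {y | act hsd y ∈ G} := by
  refine ⟨?_, BraidedSet.R.injective.injOn, ?_⟩
  · rintro ⟨x, y⟩ ⟨hx, hy⟩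
    rw [R_eq hsd]
    refine ⟨hy, ?_⟩
    change act hsd (act hsd y x) ∈ G
    rw [act_act]
    exact mul_mem (mul_mem hy hx) (inv_mem hy)
  · rintro ⟨y, w⟩ ⟨hy, hw⟩
    refine ⟨((act hsd y)⁻¹ w, y), ⟨?_, hy⟩, by rw [R_eq hsd]; simp⟩
    have h := act_act hsd ((act hsd y)⁻¹ w) y
    rw [← Perm.mul_apply, mul_inv_cancel, Perm.one_apply] at h
    have h' : act hsd ((act hsd y)⁻¹ w) = (act hsd y)⁻¹ * act hsd w * act hsd y := by
      rw [h]; group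
    change act hsd _ ∈ G
    rw [h']
    exact mul_mem (mul_mem (inv_mem hy) hw) hy

theorem act_mem_of_generated_eq_univ {ι : Type*} {s : ι → X} (hs : generated s = Set.univ)
    {G : Subgroup (Equiv.Perm X)} (hG : ∀ i, act hsd (s i) ∈ G) (y : X) : act hsd y ∈ G := by
  have hy : y ∈ generated s := hs ▸ Set.mem_univ y
  exact hy _ ⟨isBraidedSubset_act_mem hsd G, hG⟩

end Rack

/-! ### From strands to the braid group -/

section Bridge

/-- The list of labelled strands with colours `s` and labels `a`. -/
def strands {X α : Type*} {n : ℕ} (s : Fin n → X) (a : Fin n → α) : List (X × α) :=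
  List.ofFn fun i => (s i, a i)

theorem strands_injective {X α : Type*} {n : ℕ} {s s' : Fin n → X} {a a' : Fin n → α}
    (h : strands s a = strands s' a') : s = s' ∧ a = a' := by
  have h' := List.ofFn_injective h
  exact ⟨funext fun i => congrArg Prod.fst (congrFun h' i),
    funext fun i => congrArg Prod.snd (congrFun h' i)⟩

theorem exists_eq_strands {X α : Type*} {n : ℕ} {l : List (X × α)} (hl : l.length = n) :
    ∃ (s : Fin n → X) (a : Fin n → α), l = strands s a := by
  subst hl
  exact ⟨fun i => (l.get i).1, fun i => (l.get i).2, (List.ofFn_get l).symm⟩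

variable {X : Type*} [BraidedSet X] {n : ℕ}

theorem braidAction_of (i : Fin (n - 1)) (s : Fin n → X) :
    (braidAction X n (PresentedGroup.of i)).unop s = applyAt BraidedSet.R i s := by
  simp [braidAction, sigmaPerm]

theorem braidToPerm_of (i : Fin (n - 1)) :
    braidToPerm n (PresentedGroup.of i) = swap (pos i) (posSucc i) := by
  simp [braidToPerm]

theorem braidAction_mul (g h : BraidGroup n) (s : Fin n → X) :
    (braidAction X n (g * h)).unop s = (braidAction X n h).unop ((braidAction X n g).unop s) := by
  simp

theorem braidAction_inv (g : BraidGroup n) (s : Fin n → X) :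
    (braidAction X n g⁻¹).unop ((braidAction X n g).unop s) = s := by
  simp

variable [Finite X]

/-- Entry `i` of the transformed tuple is carried from position `braidToPerm n g i`, and recolouring
stays within a component. The right action on tuples matches precomposition with permutations, so
products keep their order. -/
theorem component_braidAction (hsd : IsSelfDistributive X) (g : BraidGroup n) (s : Fin n → X)
    (i : Fin n) :
    component ((braidAction X n g).unop s i) = component (s (braidToPerm n g i)) := by
  have hg : g ∈ Subgroup.closure (Set.range PresentedGroup.of) := by
    rw [PresentedGroup.closure_range_of]; trivial
  induction hg using Subgroup.closure_induction generalizing s i with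
  | mem _ h =>
    obtain ⟨j, rfl⟩ := h
    rw [braidAction_of, braidToPerm_of, applyAt, R_eq hsd]
    have := pos_ne_posSucc j
    split_ifs with h1 h2
    · rw [h1, swap_apply_left]
    · rw [h2, swap_apply_right, component_act]
    · rw [swap_apply_of_ne_of_ne h1 h2]
  | one => simp
  | mul g h _ _ ihg ihh =>
    rw [braidAction_mul, ihh, ihg, map_mul, Perm.mul_apply]
  | inv g _ ih =>
    have h := ih ((braidAction X n g⁻¹).unop s) ((braidToPerm n g)⁻¹ i)
    rw [← braidAction_mul, inv_mul_cancel] at h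
    simpa using h.symm

theorem braidStabilizer_le_coloredBraidGroup (hsd : IsSelfDistributive X) (s : Fin n → X) :
    braidStabilizer s ≤ coloredBraidGroup s := by
  intro g hg c
  have h : ∀ i, component (s (braidToPerm n g i)) = component (s i) := by
    intro i
    rw [← component_braidAction hsd, show (braidAction X n g).unop s = s from hg]
  ext i
  constructor
  · rintro ⟨j, hj, rfl⟩
    exact (h j).trans hj
  · intro hi
    refine ⟨(braidToPerm n g)⁻¹ i, ?_, by simp⟩
    have := h ((braidToPerm n g)⁻¹ i)
    rw [← Perm.mul_apply, mul_inv_cancel, Perm.one_apply] at this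
    exact this.symm.trans hi

variable (hsd : IsSelfDistributive X)

theorem strands_crossing {α : Type*} {u v : List (X × α)} {x y : X} {a b : α} {s : Fin n → X}
    {c : Fin n → α} (h : u ++ (x, a) :: (y, b) :: v = strands s c) :
    ∃ g : BraidGroup n, u ++ (y, b) :: (act hsd y x, a) :: v =
      strands ((braidAction X n g).unop s) (c ∘ braidToPerm n g) := by
  have hlen : u.length + 2 + v.length = n := by
    have := congrArg List.length h
    simp [strands] at this
    omega
  let i : Fin (n - 1) := ⟨u.length, by omega⟩
  have hk : ∀ (k : ℕ) (hk : k < n), (u ++ (x, a) :: (y, b) :: v)[k]? =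
      some (s ⟨k, hk⟩, c ⟨k, hk⟩) := by
    intro k hk
    rw [h, strands, List.getElem?_ofFn, dif_pos hk]
  have h1 : s (pos i) = x ∧ c (pos i) = a := by
    have := hk u.length (by omega)
    simp at this
    exact ⟨this.1.symm, this.2.symm⟩
  have h2 : s (posSucc i) = y ∧ c (posSucc i) = b := by
    have := hk (u.length + 1) (by omega)
    simp at this
    exact ⟨this.1.symm, this.2.symm⟩
  refine ⟨PresentedGroup.of i, List.ext_getElem? fun k => ?_⟩
  by_cases hkn : k < n
  · rw [strands, List.getElem?_ofFn, dif_pos hkn, braidAction_of, braidToPerm_of]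
    by_cases hk1 : k = u.length
    · have : (⟨k, hkn⟩ : Fin n) = pos i := Fin.ext hk1
      rw [this, Function.comp, swap_apply_left, applyAt, if_pos rfl, R_eq hsd, h2.1, h2.2, hk1]
      simp
    by_cases hk2 : k = u.length + 1
    · have : (⟨k, hkn⟩ : Fin n) = posSucc i := Fin.ext hk2
      rw [this, Function.comp, swap_apply_right, applyAt, if_neg (pos_ne_posSucc i).symm, if_pos rfl,
        R_eq hsd, h2.1, h1.1, h1.2, hk2]
      simp
    · have n1 : (⟨k, hkn⟩ : Fin n) ≠ pos i := fun h => hk1 (congrArg Fin.val h)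
      have n2 : (⟨k, hkn⟩ : Fin n) ≠ posSucc i := fun h => hk2 (congrArg Fin.val h)
      rw [Function.comp, swap_apply_of_ne_of_ne n1 n2, applyAt, if_neg n1, if_neg n2, ← hk k hkn]
      rcases lt_or_ge k u.length with hku | hku
      · rw [List.getElem?_append_left hku, List.getElem?_append_left hku]
      · rw [List.getElem?_append_right hku, List.getElem?_append_right hku]
        obtain ⟨d, hd⟩ : ∃ d, k - u.length = d + 2 := ⟨k - u.length - 2, by omega⟩
        rw [hd]
        rfl
  · rw [List.getElem?_eq_none, List.getElem?_eq_none]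
    · simp [strands]; omega
    · simp; omega

/-- Equivalent lists of strands are related by the action of the braid group. -/
theorem BraidEquiv.exists_braid {α : Type*} {l l' : List (X × α)}
    (h : BraidEquiv (act hsd) l l') : ∀ (s : Fin n → X) (c : Fin n → α), l = strands s c →
      ∃ g : BraidGroup n, l' = strands ((braidAction X n g).unop s) (c ∘ braidToPerm n g) := by
  induction h with
  | rel _ _ h =>
    obtain ⟨u, v, x, y, a, b⟩ := h
    exact fun s c hs => strands_crossing hsd hs
  | refl => exact fun s c hs => ⟨1, by simpa using hs⟩
  | symm l l' h ih =>
    intro s c hs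
    have hlen : l.length = n := by
      rw [BraidEquiv.length_eq h, hs]; simp [strands]
    -- The induction hypothesis starts from the other list, so that list is first written as a
    -- tuple; the inverse braid then leads back.
    obtain ⟨s', c', hs'⟩ := exists_eq_strands hlen
    obtain ⟨g, hg⟩ := ih s' c' hs'
    obtain ⟨rfl, rfl⟩ := strands_injective (hs.symm.trans hg)
    refine ⟨g⁻¹, ?_⟩
    rw [braidAction_inv, hs', Function.comp_assoc, ← Perm.coe_mul, ← map_mul, mul_inv_cancel]
    simp
  | trans _ _ _ _ _ ih ih' =>
    intro s c hs
    obtain ⟨g, hg⟩ := ih s c hs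
    obtain ⟨g', hg'⟩ := ih' _ _ hg
    exact ⟨g * g', by rw [hg', braidAction_mul, map_mul, Perm.coe_mul, Function.comp_assoc]⟩

/-- With the positions themselves as labels, the final labels record the permutation induced by the
braid. -/
theorem exists_mem_braidStabilizer {s : Fin n → X} {τ : Equiv.Perm (Fin n)}
    (hτ : τ ∈ labelGroup (act hsd) (strands s id)) :
    ∃ g ∈ braidStabilizer s, braidToPerm n g = τ := by
  have hm : (strands s (id : Fin n → Fin n)).map (Prod.map id τ) = strands s τ := by
    simp [strands, List.map_ofFn, Function.comp_def]
  rw [mem_labelGroup, hm] at hτ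
  obtain ⟨g, hg⟩ := hτ.symm.exists_braid hsd s id rfl
  obtain ⟨h1, h2⟩ := strands_injective hg
  exact ⟨g, h1.symm, Equiv.ext fun i => (congrFun h2 i).symm⟩

open Classical in
/-- If each component occurs sufficiently often, and the entries generate, then all the
three-cycles in a block come from the stabilizer. -/
theorem cyc_mem_labelGroup_strands {s : Fin n → X} (hs : generated s = Set.univ)
    (c : Component X)
    (hc : Nat.card X * (2 * (Nat.card X).factorial) < (block s c).ncard) {i j k : Fin n}
    (hi : i ∈ block s c) (hj : j ∈ block s c) (hk : k ∈ block s c) (hij : i ≠ j) (hik : i ≠ k)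
    (hjk : j ≠ k) : cyc i j k ∈ labelGroup (act hsd) (strands s id) := by
  have := Fintype.ofFinite X
  -- The factorial is the order of `Equiv.Perm X`, hence kills every `act x`; the factor `2` ensures
  -- `2 ≤ r` even when `X` has one element.
  set r := 2 * (Nat.card X).factorial with hr
  set l := strands s (id : Fin n → Fin n) with hl
  have hmem : ∀ i, (s i, i) ∈ l := fun i => List.mem_ofFn.2 ⟨i, rfl⟩
  have hgen : ∀ y, act hsd y ∈ colourGroup (act hsd) l :=
    act_mem_of_generated_eq_univ hsd hs fun i => mem_colourGroup (p := (s i, i)) (hmem i)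
  have hpow : ∀ x, act hsd x ^ r = 1 := by
    intro x
    have h : act hsd x ^ Nat.card (Equiv.Perm X) = 1 := pow_card_eq_one'
    rw [Nat.card_perm] at h
    rw [hr, mul_comm, pow_mul, h, one_pow]
  have hr2 : 2 ≤ r := by have := Nat.factorial_pos (Nat.card X); omega
  have hnd : (l.map Prod.snd).Nodup := by
    rw [hl, strands, List.map_ofFn]
    exact List.nodup_ofFn.2 fun _ _ h => h
  -- Pigeonhole: if every colour occurred at most `r` times in the block, its size would be at most
  -- `Nat.card X * r`.
  obtain ⟨x, hx⟩ : ∃ x, r < (Finset.univ.filter fun i => i ∈ block s c ∧ s i = x).card := by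
    by_contra! hcon
    have h1 : (block s c).ncard = (Finset.univ.filter fun i => i ∈ block s c).card := by
      rw [← Set.ncard_coe_finset]; simp
    have h2 := Finset.card_le_mul_card_image_of_maps_to
      (s := Finset.univ.filter fun i => i ∈ block s c) (t := Finset.univ) (f := s)
      (fun _ _ => Finset.mem_univ _) r (fun x _ => by
        rw [Finset.filter_filter]; exact hcon x)
    rw [Finset.card_univ, ← Nat.card_eq_fintype_card, mul_comm] at h2
    omega
  have hxc : component x = c := by
    obtain ⟨i, hi⟩ := Finset.card_pos.1 (by omega :
      0 < (Finset.univ.filter fun i => i ∈ block s c ∧ s i = x).card)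
    simp only [Finset.mem_filter] at hi
    rw [← hi.2.2]
    exact hi.2.1
  have hcount : r < (l.filter fun p => p.1 = x).length := by
    refine hx.trans_le ?_
    have : (Finset.univ.filter fun i => i ∈ block s c ∧ s i = x) ⊆
        ((l.filter fun p => p.1 = x).map Prod.snd).toFinset := by
      intro i hi
      simp only [Finset.mem_filter] at hi
      rw [List.mem_toFinset]
      exact List.mem_map.2 ⟨(s i, i), List.mem_filter.2 ⟨hmem i, by simp [hi.2.2]⟩, rfl⟩
    have h1 := (Finset.card_le_card this).trans (List.toFinset_card_le _)
    simpa using h1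
  obtain ⟨a, ha⟩ := exists_linked (act_act hsd) hpow hr2 hnd hgen x hcount
  have hlink : ∀ i ∈ block s c, Linked (labelGroup (act hsd) l) a i := fun i hi =>
    ha _ (hmem i) (exists_mem_apply_eq hsd hgen (hxc.trans (Eq.symm hi)))
  exact Linked.cyc_mem hij hik hjk ((hlink i hi).symm.trans (hlink j hj))
    ((hlink j hj).symm.trans (hlink k hk))

end Bridge

/-! ### Reduction of the theorem to three-cycles -/

theorem exists_eq_cyc {α : Type*} [Fintype α] [DecidableEq α]
    {f : Equiv.Perm α} (hf : f.IsThreeCycle) :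
    ∃ a b c, a ≠ b ∧ a ≠ c ∧ b ≠ c ∧ f = cyc a b c := by
  obtain ⟨a, ha⟩ := hf.isCycle.nonempty_support
  have h := hf.nodup_iff_mem_support.2 ha
  simp only [List.nodup_cons, List.mem_cons, List.not_mem_nil, or_false, not_or] at h
  exact ⟨a, f a, f (f a), h.1.1, h.1.2, h.2.1, hf.eq_swap_mul_swap_iff_mem_support.2 ha⟩

end Braided

open Braided in
theorem mainTheorem3 (m : ℕ) :
    ∃ N : ℕ, ∀ (X : Type*) [Finite X] [Braided.BraidedSet X],
      Nat.card X = m → Braided.IsSelfDistributive X →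
      ∀ (n : ℕ) (s : Fin n → X),
        (∀ c : Braided.Component X, N ≤ (Braided.block s c).ncard) →
        Braided.generated s = Set.univ →
        Braided.braidStabilizer s ≤ Braided.coloredBraidGroup s ∧
        Braided.alternatingProduct s ≤
          ((Braided.braidStabilizer s).subgroupOf (Braided.coloredBraidGroup s)).map
            (Braided.coloredBraidToPerm s) := by
  classical
  refine ⟨m * (2 * m.factorial) + 1, ?_⟩
  rintro X _ _ rfl hsd n s hN hs
  refine ⟨braidStabilizer_le_coloredBraidGroup hsd s, ?_⟩
  have : Finite (Component X) := Quotient.finite _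
  -- There are finitely many components, so the product is generated by its factors, and each factor
  -- by three-cycles.
  rw [alternatingProduct, Subgroup.pi_le_iff]
  intro c
  rw [← Equiv.Perm.closure_three_cycles_eq_alternating, Subgroup.map_le_iff_le_comap,
    Subgroup.closure_le]
  intro f hf
  obtain ⟨i, j, k, hij, hik, hjk, rfl⟩ := exists_eq_cyc hf
  obtain ⟨g, hg, hgτ⟩ := exists_mem_braidStabilizer hsd (cyc_mem_labelGroup_strands hsd hs c (hN c)
    i.2 j.2 k.2 (Subtype.coe_ne_coe.2 hij) (Subtype.coe_ne_coe.2 hik) (Subtype.coe_ne_coe.2 hjk))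
  refine ⟨⟨g, braidStabilizer_le_coloredBraidGroup hsd s hg⟩, hg, ?_⟩
  funext d
  ext z
  have hz : (coloredBraidToPerm s ⟨g, braidStabilizer_le_coloredBraidGroup hsd s hg⟩ d z : Fin n) =
      braidToPerm n g z := rfl
  rw [hz, hgτ, cyc_apply (Subtype.coe_ne_coe.2 hij) (Subtype.coe_ne_coe.2 hik)
    (Subtype.coe_ne_coe.2 hjk)]
  -- The braid found moves only `i`, `j`, `k`, all in block `c`, so its image is trivial in every
  -- other factor.
  by_cases hd : d = c
  · subst hd
    simp only [MonoidHom.mulSingle_apply, Pi.mulSingle_eq_same, cyc_apply hij hik hjk,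
      ← Subtype.ext_iff]
    split_ifs <;> rfl
  · have hne : ∀ w : block s c, (z : Fin n) ≠ w := fun w h =>
      hd ((show component (s z) = d from z.2).symm.trans ((congrArg (component ∘ s) h).trans w.2))
    simp [MonoidHom.mulSingle_apply, Pi.mulSingle_eq_of_ne hd, hne]
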